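/- \textbf{Conventions.} A \emph{stable system of monics} $\mathcal M_{\mathbf C}$ in a category $\mathbf C$ is a class of monomorphisms of $\mathbf C$ which contains all isomorphisms, is closed under composition, and is such that the pullback of any $m\in\mathcal M_{\mathbf C}$ along any map of $\mathbf C$ exists and lies in $\mathcal M_{\mathbf C}$; the pair $(\mathbf C,\mathcal M_{\mathbf C})$ is then called an \emph{$\mathcal M$-category}. It is \emph{locally small} if $\mathbf C$ is locally small and, for each object $X$ of $\mathbf C$, the subobjects of $X$ represented by maps in $\mathcal M_{\mathbf C}$ form a small set. The category $\mathsf{Par}(\mathbf C)=\mathsf{Par}(\mathbf C,\mathcal M_{\mathbf C})$ has the objects of $\mathbf C$, and its maps $X\to Y$ are spans $X\xleftarrow{m}Z\xrightarrow{f}Y$ with $m\in\mathcal M_{\mathbf C}$, taken up to isomorphism of spans and composed by pullback; $\mathbf C$ is included in it by $f\mapsto(1,f)$. An $\mathcal M$-category $(\mathbf C,\mathcal M_{\mathbf C})$ is \emph{cocomplete} if $\mathbf C$ has all small colimits and the inclusion $\mathbf C\hookrightarrow\mathsf{Par}(\mathbf C)$ preserves them. For a locally small category $\mathbf C$ with Yoneda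 embedding $\mathbf y$, let $\mathcal P(\mathbf C)$ be the full subcategory of $[\mathbf C^{\mathrm{op}},\mathbf{Set}]$ on the \emph{small presheaves}, that is, the small colimits of representable presheaves. If $(\mathbf C,\mathcal M_{\mathbf C})$ is an $\mathcal M$-category, let $\mathcal M_{\mathcal P(\mathbf C)}$ be the class of those maps $\mu\colon P\to Q$ of $\mathcal P(\mathbf C)$ such that for every object $D$ of $\mathbf C$ and every $\gamma\colon \mathbf yD\to Q$ there are a map $m\colon A\to D$ in $\mathcal M_{\mathbf C}$ and a map $\mathbf yA\to P$ making $$\begin{array}{ccc}\mathbf yA&\longrightarrow&P\\ {\scriptstyle \mathbf ym}\downarrow&&\downarrow{\scriptstyle\mu}\\ \mathbf yD&\xrightarrow{\ \gamma\ }&Q\end{array}$$ a pullback square in $\mathcal P(\mathbf C)$. \textbf{Lemma.} Let $(\mathbf C,\mathcal M_{\mathbf C})$ be a locally small $\mathcal M$-category. Then $(\mathcal P(\mathbf C),\mathcal M_{\mathcal P(\mathbf C)})$ is a cocomplete $\mathcal M$-category; that is, $\mathcal M_{\mathcal P(\mathbf C)}$ is a stable system of monics in $\mathcal P(\mathbf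 C)$, the category $\mathcal P(\mathbf C)$ has all small colimits, and the inclusion $\mathcal P(\mathbf C)\hookrightarrow\mathsf{Par}(\mathcal P(\mathbf C),\mathcal M_{\mathcal P(\mathbf C)})$ preserves them. Moreover: \begin{itemize} \item $\mathcal M_{\mathcal P(\mathbf C)}$ is closed under small coproducts: if $(\mu_i\colon P_i\to Q_i)_{i\in I}$ is a family in $\mathcal M_{\mathcal P(\mathbf C)}$ indexed by a small set, then $\sum_i\mu_i\colon\sum_iP_i\to\sum_iQ_i$ is in $\mathcal M_{\mathcal P(\mathbf C)}$; \item $\mathcal M_{\mathcal P(\mathbf C)}$ descends along epimorphisms: if some pullback in $\mathcal P(\mathbf C)$ of a map $\mu$ along an epimorphism of $\mathcal P(\mathbf C)$ is in $\mathcal M_{\mathcal P(\mathbf C)}$, then so is $\mu$; \item small colimits and pullbacks in $\mathcal P(\mathbf C)$ are computed pointwise: a cocone on a small diagram in $\mathcal P(\mathbf C)$ is a colimit if and only if its evaluation at each object of $\mathbf C$ is a colimit in $\mathbf{Set}$, and a square in $\mathcal P(\mathbf C)$ is a pullback if and only if its evaluation at each object of $\mathbf C$ is a pullback in $\mathbf{Set}$.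 \end{itemize} -/

import Mathlib

open CategoryTheory CategoryTheory.Limits Opposite

universe w v u

/-! ### `M`-categories -/

/-- A stable system of monics `M` in a category `C`: a class of monomorphisms which contains all
isomorphisms, is closed under composition, and such that the pullback of a member of `M` along an
arbitrary map exists and belongs to `M`.  An `M`-category is a category together with such a
class. -/
class IsStableSystemOfMonics {C : Type u} [Category.{v} C] (M : MorphismProperty C) : Prop where
  mono : ∀ {X Y : C} (m : X ⟶ Y), M m → Mono m
  of_isIso : ∀ {X Y : C} (e : X ⟶ Y), IsIso e → M e
  comp : ∀ {X Y Z : C} (m : X ⟶ Y) (n : Y ⟶ Z), M m → M n → M (m ≫ n)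
  hasPullback : ∀ {X Y Z : C} (m : X ⟶ Z) (f : Y ⟶ Z), M m → HasPullback m f
  of_isPullback : ∀ {P X Y Z : C} {fst : P ⟶ X} {snd : P ⟶ Y} {m : X ⟶ Z} {f : Y ⟶ Z},
    IsPullback fst snd m f → M m → M snd

/-- An `M`-category is locally small (relative to the universe `w` of small sets) if its
hom-sets are small and the `M`-subobjects of each object form a small set. -/
structure IsLocallySmallMCategory {C : Type u} [Category.{v} C] (M : MorphismProperty C) :
    Prop where
  stable : IsStableSystemOfMonics M
  locallySmall : LocallySmall.{w} C
  wellPowered : ∀ X : C, Small.{w} {S : Subobject X // M S.arrow}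

/-! ### The category of partial maps -/

/-- A span `X ⟵ dom ⟶ Y` whose left leg belongs to `M`. -/
structure PartialSpan {C : Type u} [Category.{v} C] (M : MorphismProperty C) (X Y : C) where
  dom : C
  incl : dom ⟶ X
  map : dom ⟶ Y
  mem : M incl

/-- Two spans are identified when there is an isomorphism between their apices which commutes with
both legs. -/
def PartialSpan.setoid {C : Type u} [Category.{v} C] (M : MorphismProperty C) (X Y : C) :
    Setoid (PartialSpan M X Y) where
  r p q := ∃ e : p.dom ≅ q.dom, e.hom ≫ q.incl = p.incl ∧ e.hom ≫ q.map = p.map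
  iseqv :=
    { refl := fun p => ⟨Iso.refl _, by simp, by simp⟩
      symm := by
        rintro p q ⟨e, h₁, h₂⟩
        exact ⟨e.symm, by simp [← h₁], by simp [← h₂]⟩
      trans := by
        rintro p q r ⟨e, h₁, h₂⟩ ⟨e', h₁', h₂'⟩
        exact ⟨e ≪≫ e', by simp [h₁', h₁], by simp [h₂', h₂]⟩ }

/-- Partial maps from `X` to `Y`: spans with left leg in `M`, up to isomorphism of spans. -/
def PartialMap {C : Type u} [Category.{v} C] (M : MorphismProperty C) (X Y : C) :
    Type (max u v) :=
  Quotient (PartialSpan.setoid M X Y)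

namespace PartialSpan

variable {C : Type u} [Category.{v} C] {M : MorphismProperty C} [IsStableSystemOfMonics M]

/-- The span `X ⟵ X ⟶ Y` with left leg the identity. -/
def ofHom (M : MorphismProperty C) [IsStableSystemOfMonics M] {X Y : C} (f : X ⟶ Y) :
    PartialSpan M X Y where
  dom := X
  incl := 𝟙 X
  map := f
  mem := IsStableSystemOfMonics.of_isIso _ inferInstance

/-- The composite of two spans formed with a given pullback `P` of the right leg of the first span
and the left leg of the second. -/
def compOf {X Y Z : C} (p : PartialSpan M X Y) (q : PartialSpan M Y Z) {P : C}
    {fst : P ⟶ p.dom} {snd : P ⟶ q.dom} (h : IsPullback fst snd p.map q.incl) :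
    PartialSpan M X Z where
  dom := P
  incl := fst ≫ p.incl
  map := snd ≫ q.map
  mem := IsStableSystemOfMonics.comp _ _
    (IsStableSystemOfMonics.of_isPullback h.flip q.mem) p.mem

theorem hasPullback {X Y Z : C} (p : PartialSpan M X Y) (q : PartialSpan M Y Z) :
    HasPullback p.map q.incl := by
  have := IsStableSystemOfMonics.hasPullback q.incl p.map q.mem
  exact hasPullback_symmetry _ _

/-- The composite of two spans formed with the chosen pullback. -/
noncomputable def comp {X Y Z : C} (p : PartialSpan M X Y) (q : PartialSpan M Y Z) :
    PartialSpan M X Z :=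
  haveI := hasPullback p q
  compOf p q (IsPullback.of_hasPullback p.map q.incl)

/-- The equivalence class of the composite depends neither on the representatives nor on the
choice of the pullback. -/
theorem compOf_rel {X Y Z : C} {p p' : PartialSpan M X Y} {q q' : PartialSpan M Y Z} {P P' : C}
    {fst : P ⟶ p.dom} {snd : P ⟶ q.dom} (h : IsPullback fst snd p.map q.incl)
    {fst' : P' ⟶ p'.dom} {snd' : P' ⟶ q'.dom} (h' : IsPullback fst' snd' p'.map q'.incl)
    (hp : (setoid M X Y).r p p') (hq : (setoid M Y Z).r q q') :
    (setoid M X Z).r (compOf p q h) (compOf p' q' h') := by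
  obtain ⟨e, he₁, he₂⟩ := hp
  obtain ⟨d, hd₁, hd₂⟩ := hq
  have hh : IsPullback (fst ≫ e.hom) (snd ≫ d.hom) p'.map q'.incl :=
    h.of_iso (Iso.refl _) e d (Iso.refl _) (by simp) (by simp) (by simp [he₂]) (by simp [hd₁])
  refine ⟨hh.isoIsPullback _ _ h', ?_, ?_⟩
  · simp [compOf, he₁]
  · simp [compOf, hd₂]

end PartialSpan

namespace PartialMap

variable {C : Type u} [Category.{v} C] {M : MorphismProperty C} [IsStableSystemOfMonics M]

/-- The total partial map given by a map of `C`. -/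
def ofHom (M : MorphismProperty C) [IsStableSystemOfMonics M] {X Y : C} (f : X ⟶ Y) :
    PartialMap M X Y :=
  Quotient.mk (PartialSpan.setoid M X Y) (PartialSpan.ofHom M f)

/-- Composition of partial maps, by pullback. -/
noncomputable def comp {X Y Z : C} (p : PartialMap M X Y) (q : PartialMap M Y Z) :
    PartialMap M X Z :=
  Quotient.map₂ (sa := PartialSpan.setoid M X Y) (sb := PartialSpan.setoid M Y Z)
    (sc := PartialSpan.setoid M X Z) PartialSpan.comp
    (fun _ _ hp _ _ hq => PartialSpan.compOf_rel _ _ hp hq) p q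

theorem mk_comp_mk {X Y Z : C} (p : PartialSpan M X Y) (q : PartialSpan M Y Z) {P : C}
    {fst : P ⟶ p.dom} {snd : P ⟶ q.dom} (h : IsPullback fst snd p.map q.incl) :
    comp (Quotient.mk (PartialSpan.setoid M X Y) p) (Quotient.mk (PartialSpan.setoid M Y Z) q) =
      Quotient.mk (PartialSpan.setoid M X Z) (PartialSpan.compOf p q h) :=
  Quotient.sound (s := PartialSpan.setoid M X Z)
    (PartialSpan.compOf_rel _ _ ((PartialSpan.setoid M X Y).refl p)
      ((PartialSpan.setoid M Y Z).refl q))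

theorem ofHom_comp_mk {X Y Z : C} (f : X ⟶ Y) (q : PartialSpan M Y Z) {P : C}
    {fst : P ⟶ X} {snd : P ⟶ q.dom} (h : IsPullback fst snd f q.incl) (hfst : M fst) :
    comp (ofHom M f) (Quotient.mk (PartialSpan.setoid M Y Z) q) =
      Quotient.mk (PartialSpan.setoid M X Z) ⟨P, fst, snd ≫ q.map, hfst⟩ := by
  refine (mk_comp_mk (PartialSpan.ofHom M f) q h).trans ?_
  refine Quotient.sound (s := PartialSpan.setoid M X Z) ⟨Iso.refl _, ?_, ?_⟩ <;>
    simp [PartialSpan.compOf, PartialSpan.ofHom]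

theorem id_comp {X Y : C} (p : PartialMap M X Y) : comp (ofHom M (𝟙 X)) p = p := by
  induction p using Quotient.inductionOn with
  | h p =>
    refine (ofHom_comp_mk (𝟙 X) p (fst := p.incl) (snd := 𝟙 p.dom)
      (IsPullback.of_vert_isIso ⟨by simp⟩) p.mem).trans ?_
    exact Quotient.sound (s := PartialSpan.setoid M X Y) ⟨Iso.refl _, by simp, by simp⟩

theorem comp_id {X Y : C} (p : PartialMap M X Y) : comp p (ofHom M (𝟙 Y)) = p := by
  induction p using Quotient.inductionOn with
  | h p =>
    have : @IsIso C _ Y Y (PartialSpan.ofHom M (𝟙 Y)).incl := inferInstanceAs (IsIso (𝟙 Y))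
    have h : IsPullback (𝟙 p.dom) p.map p.map (PartialSpan.ofHom M (𝟙 Y)).incl :=
      IsPullback.of_horiz_isIso ⟨by simp [PartialSpan.ofHom]⟩
    refine (mk_comp_mk p (PartialSpan.ofHom M (𝟙 Y)) h).trans ?_
    refine Quotient.sound (s := PartialSpan.setoid M X Y) ⟨Iso.refl _, ?_, ?_⟩ <;>
      simp [PartialSpan.compOf, PartialSpan.ofHom]

theorem assoc {W X Y Z : C} (p : PartialMap M W X) (q : PartialMap M X Y)
    (r : PartialMap M Y Z) : comp (comp p q) r = comp p (comp q r) := by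
  induction p using Quotient.inductionOn with
  | h p =>
  induction q using Quotient.inductionOn with
  | h q =>
  induction r using Quotient.inductionOn with
  | h r =>
    have := PartialSpan.hasPullback p q
    have := PartialSpan.hasPullback q r
    have hA := IsPullback.of_hasPullback p.map q.incl
    have hB := IsPullback.of_hasPullback q.map r.incl
    have := IsStableSystemOfMonics.hasPullback (M := M) (pullback.fst q.map r.incl)
      (pullback.snd p.map q.incl)
      (IsStableSystemOfMonics.of_isPullback hB.flip r.mem)
    have := hasPullback_symmetry (pullback.fst q.map r.incl) (pullback.snd p.map q.incl)
    have hT := IsPullback.of_hasPullback (pullback.snd p.map q.incl) (pullback.fst q.map r.incl)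
    have h₁ := hT.flip.paste_vert hA.flip
    have h₂ := hT.paste_vert hB
    rw [mk_comp_mk p q hA, mk_comp_mk q r hB,
      mk_comp_mk (PartialSpan.compOf p q hA) r h₂,
      mk_comp_mk p (PartialSpan.compOf q r hB) h₁.flip]
    exact Quotient.sound (s := PartialSpan.setoid M W Z)
      ⟨Iso.refl _, by simp [PartialSpan.compOf], by simp [PartialSpan.compOf]⟩

theorem ofHom_comp {X Y Z : C} (f : X ⟶ Y) (g : Y ⟶ Z) :
    comp (ofHom M f) (ofHom M g) = ofHom M (f ≫ g) := by
  have : IsIso (PartialSpan.ofHom M g).incl := inferInstanceAs (IsIso (𝟙 Y))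
  refine (ofHom_comp_mk f (PartialSpan.ofHom M g) (fst := 𝟙 X) (snd := f)
    (IsPullback.of_horiz_isIso ⟨by simp [PartialSpan.ofHom]⟩)
    (PartialSpan.ofHom M f).mem).trans rfl

end PartialMap

/-- The category `Par(C, M)` of partial maps: same objects as `C`, and partial maps as maps. -/
structure Par {C : Type u} [Category.{v} C] (M : MorphismProperty C) where
  of : C

noncomputable instance Par.category {C : Type u} [Category.{v} C] (M : MorphismProperty C)
    [IsStableSystemOfMonics M] : Category.{max u v} (Par M) where
  Hom X Y := PartialMap M X.of Y.of
  id X := PartialMap.ofHom M (𝟙 X.of)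
  comp p q := PartialMap.comp p q
  id_comp p := PartialMap.id_comp p
  comp_id p := PartialMap.comp_id p
  assoc p q r := PartialMap.assoc p q r

/-- The inclusion of `C` into `Par(C, M)`: identity on objects, `f ↦ (1, f)` on maps. -/
noncomputable def Par.inclusion {C : Type u} [Category.{v} C] (M : MorphismProperty C)
    [IsStableSystemOfMonics M] : C ⥤ Par M where
  obj X := ⟨X⟩
  map f := PartialMap.ofHom M f
  map_id _ := rfl
  map_comp f g := (PartialMap.ofHom_comp f g).symm

/-- `(C, M)` is a cocomplete `M`-category: `M` is a stable system of monics, `C` has all small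
colimits, and the inclusion of `C` into `Par(C, M)` preserves them. -/
structure IsCocompleteMCategory {C : Type u} [Category.{v} C] (M : MorphismProperty C) :
    Prop where
  stable : IsStableSystemOfMonics M
  hasColimits : HasColimitsOfSize.{w, w} C
  preservesColimits : PreservesColimitsOfSize.{w, w} (Par.inclusion M)

/-! ### Small presheaves -/

/-- A presheaf is small if it is a small colimit of representable presheaves. -/
def isSmallPresheaf (C : Type u) [Category.{v} C] : ObjectProperty (Cᵒᵖ ⥤ Type v) := fun P =>
  ∃ (I : Type v) (_ : Category.{v} I) (D : I ⥤ C) (c : Cocone (D ⋙ yoneda)),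
    Nonempty (IsColimit c) ∧ Nonempty (c.pt ≅ P)

theorem isSmallPresheaf_yoneda {C : Type u} [Category.{v} C] (X : C) :
    isSmallPresheaf C (yoneda.obj X) :=
  ⟨PUnit.{v + 1}, inferInstance, (Functor.const _).obj X,
    ⟨yoneda.obj X, { app := fun _ => 𝟙 _ }⟩,
    ⟨{ desc := fun s => s.ι.app ⟨⟩
       uniq := fun s m hm => by simpa using hm ⟨⟩ }⟩, ⟨Iso.refl _⟩⟩

/-- The category of small presheaves on `C`, a full subcategory of the category of presheaves. -/
abbrev SmallPresheaf (C : Type u) [Category.{v} C] := (isSmallPresheaf C).FullSubcategory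

/-- The Yoneda embedding into small presheaves. -/
def smallYoneda (C : Type u) [Category.{v} C] : C ⥤ SmallPresheaf C :=
  (isSmallPresheaf C).lift yoneda isSmallPresheaf_yoneda

/-- Evaluation of small presheaves at an object of `C`. -/
def SmallPresheaf.eval {C : Type u} [Category.{v} C] (A : C) : SmallPresheaf C ⥤ Type v :=
  (isSmallPresheaf C).ι ⋙ (evaluation Cᵒᵖ (Type v)).obj (op A)

/-- The class of maps `μ : P ⟶ Q` of small presheaves such that for each `γ : yD ⟶ Q` there is an
`m : A ⟶ D` in `M` for which `ym : yA ⟶ yD` is a pullback of `μ` along `γ`. -/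
def smallPresheafMaps {C : Type u} [Category.{v} C] (M : MorphismProperty C) :
    MorphismProperty (SmallPresheaf C) := fun P Q μ =>
  ∀ (D : C) (γ : (smallYoneda C).obj D ⟶ Q),
    ∃ (A : C) (m : A ⟶ D) (t : (smallYoneda C).obj A ⟶ P),
      M m ∧ IsPullback t ((smallYoneda C).map m) μ γ

/-! Everything rests on two facts about a colimit of sets, both stable under pointwise evaluation.
Colimits are universal, and an equifibered family of monomorphisms over the diagram descends: the
comparison of colimits pulls back along each leg to the given family. Small presheaves are closed
under small colimits, and representables detect both elements and pullbacks, so both facts hold for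
small presheaves. By `PartialMap.ofHom_comp_mk_eq_iff`, a cocone in `Par` is an equifibered family
in `M` together with a cocone on its domains. Descent then produces the induced partial map and
universality makes it unique; this is `Par.nonempty_isColimit_inclusion_mapCocone`. Membership in
the class is tested on representables, which lift through colimits (via some leg) and through
epimorphisms, so closure under coproducts and descent follow by pasting pullbacks. The delicate
point in stability is that the pullbacks are small, which is `isSmallPresheaf_of_isPullback`. -/

/-! ### Universality and descent for colimits of sets -/

namespace CategoryTheory.Limits.Types

variable {J : Type v} [Category.{v} J] {F : J ⥤ Type v} {c : Cocone F}

/-- A compatible family of functions out of a diagram extends along a colimit cocone. -/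
theorem exists_desc_of_isColimit (hc : IsColimit c) {T : Type v} (g : ∀ j, F.obj j → T)
    (hg : ∀ ⦃i j : J⦄ (u : i ⟶ j) (x : F.obj i), g j (F.map u x) = g i x) :
    ∃ h : c.pt → T, ∀ j x, h (c.ι.app j x) = g j x := by
  let s : Cocone F :=
    { pt := T
      ι := { app := fun j => ↾(g j)
             naturality := fun i j u => by ext x; exact hg u x } }
  exact ⟨fun x => hc.desc s x, fun j x => ConcreteCategory.congr_hom (hc.fac s j) x⟩

/-- For an equifibered family of sets over a diagram, the elements of the family over a given
element of the colimit are, up to identification, those over any of its representatives. -/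
theorem exists_rep_of_equifibered (hc : IsColimit c) {F' : J ⥤ Type v} {α : F' ⟶ F}
    (hα : NatTrans.Equifibered α) {T : Type v} (k : ∀ j, F'.obj j → T)
    (hk : ∀ ⦃i j : J⦄ (u : i ⟶ j) (x : F'.obj i), k j (F'.map u x) = k i x)
    {i j : J} (y : F'.obj i) (z : F.obj j) (h : c.ι.app i (α.app i y) = c.ι.app j z) :
    ∃ y' : F'.obj j, α.app j y' = z ∧ k j y' = k i y := by
  -- Send `z` to the set of `k`-values on its fibre. Equifiberedness makes this compatible with the
  -- transition maps, so it depends only on the class of `z` in the colimit; no zigzags are needed.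
  obtain ⟨g, hg⟩ := exists_desc_of_isColimit hc
    (fun j z => ({t | ∃ y : F'.obj j, α.app j y = z ∧ k j y = t} : Set T)) (by
      intro i j u x
      ext t
      constructor
      · rintro ⟨y, hy, rfl⟩
        obtain ⟨y', h₁, h₂⟩ := exists_of_isPullback (hα u) y x hy
        exact ⟨y', h₂, by rw [← h₁, hk]⟩
      · rintro ⟨y, rfl, rfl⟩
        exact ⟨F'.map u y, (ConcreteCategory.congr_hom (hα u).w y), hk u y⟩)
  have h₁ : k i y ∈ g (c.ι.app i (α.app i y)) := by
    rw [hg]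
    exact ⟨y, rfl, rfl⟩
  rw [h, hg] at h₁
  exact h₁

theorem isUniversalColimit_of_isColimit (hc : IsColimit c) : IsUniversalColimit c := by
  intro F' c' α f hw hα hp
  have hw' : ∀ j x, f (c'.ι.app j x) = c.ι.app j (α.app j x) := fun j x =>
    (ConcreteCategory.congr_hom (NatTrans.congr_app hw j) x).symm
  have surj : ∀ x : c'.pt, ∃ j y, c'.ι.app j y = x := fun x => by
    obtain ⟨j, z, hz⟩ := jointly_surjective_of_isColimit hc (f x)
    obtain ⟨y, hy, -⟩ := exists_of_isPullback (hp j) x z hz.symm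
    exact ⟨j, y, hy⟩
  have key : ∀ (s : Cocone F') (i j : J) (y : F'.obj i) (y' : F'.obj j),
      c'.ι.app i y = c'.ι.app j y' → s.ι.app i y = s.ι.app j y' := fun s i j y y' h => by
    -- Pairing the two legs moves `y` to the fibre of `y'` while keeping its images in both `c'.pt`
    -- and `s.pt`; the pullback at `j` then identifies the result with `y'`.
    obtain ⟨y'', h₁, h₂⟩ := exists_rep_of_equifibered hc hα
      (k := fun j x => (c'.ι.app j x, s.ι.app j x)) (fun i j u x => by
        rw [← c'.w u, ← s.w u]; rfl) y (α.app j y') (by rw [← hw', ← hw', h])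
    rw [Prod.mk.injEq] at h₂
    have : y'' = y' := ext_of_isPullback (hp j) (h₂.1.trans h) h₁
    rw [← this, h₂.2]
  choose J' Y hY using surj
  exact ⟨{
    desc := fun s => ↾(fun x => s.ι.app _ (Y x))
    fac := fun s j => by
      ext x
      exact key s _ _ _ _ (hY _)
    uniq := fun s m hm => by
      ext x
      exact (congrArg m (hY x)).symm.trans (ConcreteCategory.congr_hom (hm _) (Y x)) }⟩

/-- Uniqueness in the pullback is immediate from injectivity of `α`; existence comes from moving a
representative into the required fibre without changing its class in `c'.pt`. -/
theorem isPullback_of_equifibered_of_mono (hc : IsColimit c) {F' : J ⥤ Type v} {c' : Cocone F'}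
    (hc' : IsColimit c') {α : F' ⟶ F} (f : c'.pt ⟶ c.pt)
    (hw : ∀ j, α.app j ≫ c.ι.app j = c'.ι.app j ≫ f)
    (hα : NatTrans.Equifibered α) [∀ j, Mono (α.app j)] (j : J) :
    IsPullback (c'.ι.app j) (α.app j) f (c.ι.app j) := by
  have inj : ∀ j, Function.Injective (α.app j) := fun j => (mono_iff_injective _).1 inferInstance
  have hw' : ∀ j x, f (c'.ι.app j x) = c.ι.app j (α.app j x) := fun j x =>
    (ConcreteCategory.congr_hom (hw j) x).symm
  rw [isPullback_iff]
  refine ⟨(hw j).symm, fun x y h => inj j h.2, fun x z h => ?_⟩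
  obtain ⟨i, y, rfl⟩ := jointly_surjective_of_isColimit hc' x
  obtain ⟨y', h₁, h₂⟩ := exists_rep_of_equifibered hc hα
      (k := fun j x => c'.ι.app j x) (fun i j u x => by rw [← c'.w u]; rfl) y z (by rw [← hw', h])
  exact ⟨y', h₂, h₁⟩

end CategoryTheory.Limits.Types

/-! ### Small presheaves are closed under small colimits -/

section Presheaf

variable {C : Type u} [Category.{v} C]

theorem Presheaf.hom_ext_of_yoneda {P Q : Cᵒᵖ ⥤ Type v} {f g : P ⟶ Q}
    (h : ∀ (A : C) (x : yoneda.obj A ⟶ P), x ≫ f = x ≫ g) : f = g := by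
  ext A x
  have := congrArg yonedaEquiv (h A.unop (yonedaEquiv.symm x))
  rwa [yonedaEquiv_comp, yonedaEquiv_comp, Equiv.apply_symm_apply] at this

theorem Presheaf.exists_fac_of_isColimit {J : Type v} [Category.{v} J]
    {F : J ⥤ Cᵒᵖ ⥤ Type v} {c : Cocone F} (hc : IsColimit c) {A : C} (x : yoneda.obj A ⟶ c.pt) :
    ∃ (j : J) (y : yoneda.obj A ⟶ F.obj j), y ≫ c.ι.app j = x := by
  obtain ⟨j, y, hy⟩ := Types.jointly_surjective_of_isColimit
    (isColimitOfPreserves ((evaluation Cᵒᵖ (Type v)).obj (op A)) hc) (yonedaEquiv x)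
  refine ⟨j, yonedaEquiv.symm y, yonedaEquiv.injective ?_⟩
  rw [yonedaEquiv_comp, Equiv.apply_symm_apply]
  exact hy

/-- A small family of elements of a presheaf `P` which exhibits `P` as the colimit of the
corresponding full subcategory of its category of elements. -/
structure IsPresentedBy (P : Cᵒᵖ ⥤ Type v) {V : Type v} (X : V → C)
    (x : ∀ a, yoneda.obj (X a) ⟶ P) : Prop where
  exists_fac : ∀ {A : C} (p : yoneda.obj A ⟶ P), ∃ (a : V) (f : A ⟶ X a), yoneda.map f ≫ x a = p
  exists_desc : ∀ {Q : Cᵒᵖ ⥤ Type v} (y : ∀ a, yoneda.obj (X a) ⟶ Q),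
    (∀ a b (f : X a ⟶ X b), yoneda.map f ≫ x b = x a → yoneda.map f ≫ y b = y a) →
      ∃ φ : P ⟶ Q, ∀ a, x a ≫ φ = y a

namespace IsPresentedBy

variable {P : Cᵒᵖ ⥤ Type v} {V : Type v} {X : V → C} {x : ∀ a, yoneda.obj (X a) ⟶ P}

theorem hom_ext (h : IsPresentedBy P X x) {Q : Cᵒᵖ ⥤ Type v} {f g : P ⟶ Q}
    (hfg : ∀ a, x a ≫ f = x a ≫ g) : f = g :=
  Presheaf.hom_ext_of_yoneda fun A p => by
    obtain ⟨a, k, rfl⟩ := h.exists_fac p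
    rw [Category.assoc, Category.assoc, hfg]

/-- The indexing category is the full subcategory of elements spanned by the family. It is small
because the family is small and the hom-sets already are. -/
theorem isSmallPresheaf (h : IsPresentedBy P X x) : isSmallPresheaf C P := by
  let D : V → CostructuredArrow yoneda P := fun a => CostructuredArrow.mk (x a)
  let c : Cocone ((inducedFunctor D ⋙ CostructuredArrow.proj yoneda P) ⋙ yoneda) :=
    { pt := P
      ι := { app := fun a => x a
             naturality := fun a b f =>
               (CostructuredArrow.w f.hom).trans (Category.comp_id _).symm } }
  have H : ∀ s : Cocone ((inducedFunctor D ⋙ CostructuredArrow.proj yoneda P) ⋙ yoneda),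
      ∃ φ : P ⟶ s.pt, ∀ a, x a ≫ φ = s.ι.app a := fun s =>
    h.exists_desc (fun a => s.ι.app a) fun a b f hf =>
      s.w (j := (b : InducedCategory _ D)) (j' := (a : InducedCategory _ D))
        (InducedCategory.homMk (CostructuredArrow.homMk f hf))
  choose φ hφ using H
  exact ⟨InducedCategory _ D, inferInstance, _, c, ⟨{
    desc := φ
    fac := hφ
    uniq := fun s m hm => h.hom_ext fun a => (hm a).trans (hφ s a).symm }⟩, ⟨Iso.refl _⟩⟩

end IsPresentedBy

theorem isSmallPresheaf.exists_isPresentedBy {P : Cᵒᵖ ⥤ Type v} (h : isSmallPresheaf C P) :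
    ∃ (V : Type v) (X : V → C) (x : ∀ a, yoneda.obj (X a) ⟶ P), IsPresentedBy P X x := by
  obtain ⟨I, _, D, c, ⟨hc⟩, ⟨e⟩⟩ := h
  refine ⟨I, D.obj, fun i => c.ι.app i ≫ e.hom, fun p => ?_, fun y hy => ?_⟩
  · obtain ⟨i, f, hf⟩ := Presheaf.exists_fac_of_isColimit hc (p ≫ e.inv)
    obtain ⟨f, rfl⟩ := yoneda.map_surjective f
    exact ⟨i, f, by rw [← Category.assoc]; exact (Iso.eq_comp_inv e).1 hf⟩
  · let s : Cocone (D ⋙ yoneda) :=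
      { pt := _
        ι := { app := y
               naturality := fun i j f => by
                 simpa using hy i j (D.map f) (by
                   rw [← Category.assoc]; exact congrArg (· ≫ e.hom) (c.w f)) } }
    exact ⟨e.inv ≫ hc.desc s, fun i => by
      rw [Category.assoc, Iso.hom_inv_id_assoc]
      exact hc.fac s i⟩

/-- The union of presenting families of the `F.obj j`, pushed into the colimit, presents it.
Presentations by full subcategories of elements avoid any coherent choice of diagrams for the
separate `F.obj j`. -/
theorem isSmallPresheaf_of_isColimit {J : Type v} [Category.{v} J] {F : J ⥤ Cᵒᵖ ⥤ Type v}
    {c : Cocone F} (hc : IsColimit c) (hF : ∀ j, isSmallPresheaf C (F.obj j)) :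
    isSmallPresheaf C c.pt := by
  choose V X x h using fun j => (hF j).exists_isPresentedBy
  refine IsPresentedBy.isSmallPresheaf (V := Σ j, V j) (X := fun a => X a.1 a.2)
    (x := fun a => x a.1 a.2 ≫ c.ι.app a.1) ⟨fun p => ?_, fun {Q} y hy => ?_⟩
  · obtain ⟨j, q, rfl⟩ := Presheaf.exists_fac_of_isColimit hc p
    obtain ⟨a, f, rfl⟩ := (h j).exists_fac q
    exact ⟨⟨j, a⟩, f, (Category.assoc _ _ _).symm⟩
  · have H : ∀ j, ∃ φ : F.obj j ⟶ Q, ∀ a, x j a ≫ φ = y ⟨j, a⟩ := fun j =>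
      (h j).exists_desc (fun a => y ⟨j, a⟩) fun a b f hf =>
        hy ⟨j, a⟩ ⟨j, b⟩ f (by rw [← Category.assoc, hf])
    choose φ hφ using H
    let s : Cocone F :=
      { pt := Q
        ι := { app := φ
               naturality := fun i j u => by
                 refine (h i).hom_ext fun a => ?_
                 -- The transition map need not carry generators to generators, but the image of one
                 -- factors through a generator at `j`, and that factorization is a map of elements
                 -- over the colimit.
                 obtain ⟨b, f, hf⟩ := (h j).exists_fac (x i a ≫ F.map u)
                 have := hy ⟨i, a⟩ ⟨j, b⟩ f (by
                   rw [← Category.assoc, hf, Category.assoc, c.w])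
                 rw [← Category.assoc, ← hf, Category.assoc, hφ, this]
                 simp [hφ] } }
    exact ⟨hc.desc s, fun a => by
      rw [Category.assoc, hc.fac]
      exact hφ _ _⟩

instance : (isSmallPresheaf C).IsClosedUnderIsomorphisms where
  of_iso e := by
    rintro ⟨I, _, D, c, hc, ⟨e'⟩⟩
    exact ⟨I, _, D, c, hc, ⟨e' ≪≫ e⟩⟩

instance (J : Type v) [Category.{v} J] : (isSmallPresheaf C).IsClosedUnderColimitsOfShape J where
  colimitsOfShape_le := by
    rintro P ⟨h⟩
    exact isSmallPresheaf_of_isColimit h.isColimit h.prop_diag_obj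

end Presheaf

/-! ### Colimits and pullbacks of small presheaves -/

section Presheaf

variable {C : Type u} [Category.{v} C]

theorem Presheaf.isUniversalColimit_of_isColimit {J : Type v} [Category.{v} J]
    {F : J ⥤ Cᵒᵖ ⥤ Type v} {c : Cocone F} (hc : IsColimit c) : IsUniversalColimit c :=
  fun _ c' α f hw hα hp => ⟨evaluationJointlyReflectsColimits _ fun A =>
    (Types.isUniversalColimit_of_isColimit
      (isColimitOfPreserves ((evaluation Cᵒᵖ (Type v)).obj A) hc)
      (((evaluation Cᵒᵖ (Type v)).obj A).mapCocone c')
      (Functor.whiskerRight α ((evaluation Cᵒᵖ (Type v)).obj A)) (f.app A)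
      (by ext j : 2; exact NatTrans.congr_app (NatTrans.congr_app hw j) A)
      (hα.whiskerRight _) fun j => (hp j).app A).some⟩

/-- A pullback of a small presheaf along a map all of whose pullbacks along maps from
representables are representable is small. -/
theorem isSmallPresheaf_of_isPullback {W R P Q : Cᵒᵖ ⥤ Type v} {a : W ⟶ P} {b : W ⟶ R}
    {m : P ⟶ Q} {f : R ⟶ Q} (h : IsPullback a b m f) (hR : isSmallPresheaf C R)
    (hm : ∀ (D : C) (γ : yoneda.obj D ⟶ Q), ∃ (A : C) (t : yoneda.obj A ⟶ P)
      (n : yoneda.obj A ⟶ yoneda.obj D), IsPullback t n m γ) : isSmallPresheaf C W := by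
  -- Pulling the colimit presentation of `R` back along `b` exhibits `W`, by universality, as a
  -- colimit of pullbacks of `m` along maps from representables.
  obtain ⟨I, _, D, c, ⟨hc⟩, ⟨e⟩⟩ := hR
  let F' := pullback c.ι ((Functor.const I).map (b ≫ e.inv))
  let α : F' ⟶ D ⋙ yoneda := pullback.fst _ _
  let c' : Cocone F' := ⟨W, pullback.snd _ _⟩
  have hp : IsPullback α c'.ι c.ι ((Functor.const I).map (b ≫ e.inv)) :=
    IsPullback.of_hasPullback _ _
  have hp' : ∀ i, IsPullback (c'.ι.app i) (α.app i) (b ≫ e.inv) (c.ι.app i) :=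
    fun i => (hp.app i).flip
  have hα : NatTrans.Equifibered α := fun i j u =>
    IsPullback.of_right (h₁₂ := c'.ι.app j) (h₂₂ := c.ι.app j) (v₁₃ := b ≫ e.inv)
      (by rw [c'.w, c.w]; exact hp' i) (α.naturality u) (hp' j)
  obtain ⟨hc'⟩ := Presheaf.isUniversalColimit_of_isColimit hc c' α (b ≫ e.inv) hp.w hα hp'
  refine isSmallPresheaf_of_isColimit hc' fun i => ?_
  have h' : IsPullback (c'.ι.app i) (α.app i) b (c.ι.app i ≫ e.hom) :=
    (hp' i).of_iso (Iso.refl _) (Iso.refl _) (Iso.refl _) e (by simp) (by simp) (by simp) (by simp)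
  obtain ⟨A, t, n, hA⟩ := hm (D.obj i) ((c.ι.app i ≫ e.hom) ≫ f)
  exact (isSmallPresheaf C).prop_of_iso (hA.isoIsPullback _ _ (h'.flip.paste_vert h.flip).flip)
    (isSmallPresheaf_yoneda A)

namespace SmallPresheaf

/-- The Yoneda lemma for small presheaves. -/
def yonedaEquiv {A : C} {P : SmallPresheaf C} :
    ((smallYoneda C).obj A ⟶ P) ≃ (eval A).obj P :=
  (isSmallPresheaf C).fullyFaithfulι.homEquiv.trans CategoryTheory.yonedaEquiv

theorem yonedaEquiv_comp {A : C} {P Q : SmallPresheaf C} (x : (smallYoneda C).obj A ⟶ P)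
    (f : P ⟶ Q) : yonedaEquiv (x ≫ f) = (eval A).map f (yonedaEquiv x) :=
  rfl

theorem hom_ext_of_yoneda {P Q : SmallPresheaf C} {f g : P ⟶ Q}
    (h : ∀ (A : C) (x : (smallYoneda C).obj A ⟶ P), x ≫ f = x ≫ g) : f = g :=
  ObjectProperty.hom_ext _ (Presheaf.hom_ext_of_yoneda fun A x =>
    congrArg (·.hom) (h A (ObjectProperty.homMk x)))

instance hasColimitsOfSize : HasColimitsOfSize.{v, v} (SmallPresheaf C) where

instance preservesColimitsOfSize_eval (A : C) :
    PreservesColimitsOfSize.{v, v} (eval (C := C) A) where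
  preservesColimitsOfShape := by
    unfold eval
    infer_instance

theorem nonempty_isColimit_iff {J : Type v} [Category.{v} J] {F : J ⥤ SmallPresheaf C}
    {c : Cocone F} :
    Nonempty (IsColimit c) ↔ ∀ A : C, Nonempty (IsColimit ((eval A).mapCocone c)) :=
  ⟨fun ⟨h⟩ A => ⟨isColimitOfPreserves (eval A) h⟩, fun h =>
    ⟨isColimitOfReflects (isSmallPresheaf C).ι
      (evaluationJointlyReflectsColimits _ fun A => (h A.unop).some)⟩⟩

/-- Representables are themselves small, so the universal property tested on them alone already
gives the pointwise statement, by Yoneda. -/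
theorem isPullback_iff {P Q R S : SmallPresheaf C} {t : P ⟶ Q} {l : P ⟶ R} {r : Q ⟶ S}
    {b : R ⟶ S} :
    IsPullback t l r b ↔ ∀ A : C, IsPullback ((eval A).map t) ((eval A).map l)
      ((eval A).map r) ((eval A).map b) := by
  constructor
  · intro h A
    rw [Types.isPullback_iff]
    refine ⟨by rw [← Functor.map_comp, h.w, Functor.map_comp], fun x y hxy => ?_,
      fun x y hxy => ?_⟩
    · obtain ⟨x, rfl⟩ := yonedaEquiv.surjective x
      obtain ⟨y, rfl⟩ := yonedaEquiv.surjective y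
      simp only [← yonedaEquiv_comp, EmbeddingLike.apply_eq_iff_eq] at hxy
      rw [h.hom_ext hxy.1 hxy.2]
    · obtain ⟨x, rfl⟩ := yonedaEquiv.surjective x
      obtain ⟨y, rfl⟩ := yonedaEquiv.surjective y
      simp only [← yonedaEquiv_comp, EmbeddingLike.apply_eq_iff_eq] at hxy
      exact ⟨yonedaEquiv (h.lift x y hxy), by rw [← yonedaEquiv_comp, h.lift_fst],
        by rw [← yonedaEquiv_comp, h.lift_snd]⟩
  · intro h
    have h' : IsPullback ((isSmallPresheaf C).ι.map t) ((isSmallPresheaf C).ι.map l)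
        ((isSmallPresheaf C).ι.map r) ((isSmallPresheaf C).ι.map b) :=
      IsPullback.of_forall_isPullback_app fun A => h A.unop
    exact h'.of_map_of_faithful _

theorem isPullback_ι_map {P Q R S : SmallPresheaf C} {t : P ⟶ Q} {l : P ⟶ R} {r : Q ⟶ S}
    {b : R ⟶ S} (h : IsPullback t l r b) : IsPullback t.hom l.hom r.hom b.hom :=
  IsPullback.of_forall_isPullback_app fun A => isPullback_iff.1 h A.unop

instance (A : C) : (eval (C := C) A).PreservesMonomorphisms where
  preserves f _ := IsKernelPair.mono_of_isIso_fst (isPullback_iff.1 (IsKernelPair.id_of_mono f) A)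

theorem exists_fac_of_isColimit {J : Type v} [Category.{v} J]
    {F : J ⥤ SmallPresheaf C} {c : Cocone F} (hc : IsColimit c) {A : C}
    (x : (smallYoneda C).obj A ⟶ c.pt) :
    ∃ (j : J) (y : (smallYoneda C).obj A ⟶ F.obj j), y ≫ c.ι.app j = x := by
  obtain ⟨j, y, hy⟩ := Presheaf.exists_fac_of_isColimit
    (isColimitOfPreserves (isSmallPresheaf C).ι hc) x.hom
  exact ⟨j, ObjectProperty.homMk y, ObjectProperty.hom_ext _ hy⟩

theorem exists_fac_of_epi {P Q : SmallPresheaf C} (f : P ⟶ Q) [Epi f] {A : C}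
    (x : (smallYoneda C).obj A ⟶ Q) : ∃ y : (smallYoneda C).obj A ⟶ P, y ≫ f = x := by
  -- Evaluation preserves the pushout of `f` with itself, hence the epimorphism `f`. The universe
  -- shrinking is needed because the span shape lives in universe `0`.
  have : HasPushout f f := by
    have := hasColimitsOfSizeShrink.{0, 0, v, v} (SmallPresheaf C)
    infer_instance
  have := preservesColimitsOfSize_shrink.{0, v, 0, v} (eval (C := C) A)
  have : Epi ((eval A).map f) := inferInstance
  obtain ⟨y, hy⟩ := (epi_iff_surjective _).1 this (yonedaEquiv x)
  obtain ⟨y, rfl⟩ := yonedaEquiv.surjective y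
  exact ⟨y, yonedaEquiv.injective hy⟩

theorem isUniversalColimit_of_isColimit {J : Type v} [Category.{v} J]
    {F : J ⥤ SmallPresheaf C} {c : Cocone F} (hc : IsColimit c) : IsUniversalColimit c :=
  fun _ c' α f hw hα hp => nonempty_isColimit_iff.2 fun A =>
    Types.isUniversalColimit_of_isColimit (isColimitOfPreserves (eval A) hc)
      ((eval A).mapCocone c') (Functor.whiskerRight α (eval A)) ((eval A).map f)
      (by
        ext j : 2
        exact ((eval A).map_comp _ _).symm.trans
          (((eval A).congr_map (NatTrans.congr_app hw j)).trans ((eval A).map_comp _ _)))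
      (fun _ _ u => isPullback_iff.1 (hα u) A) fun j => isPullback_iff.1 (hp j) A

theorem isPullback_of_equifibered_of_mono {J : Type v} [Category.{v} J]
    {F : J ⥤ SmallPresheaf C} {c : Cocone F} (hc : IsColimit c) {F' : J ⥤ SmallPresheaf C}
    {c' : Cocone F'} (hc' : IsColimit c') {α : F' ⟶ F} (f : c'.pt ⟶ c.pt)
    (hw : ∀ j, α.app j ≫ c.ι.app j = c'.ι.app j ≫ f)
    (hα : NatTrans.Equifibered α) [∀ j, Mono (α.app j)] (j : J) :
    IsPullback (c'.ι.app j) (α.app j) f (c.ι.app j) :=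
  isPullback_iff.2 fun A =>
    have : ∀ j, Mono ((Functor.whiskerRight α (eval A)).app j) := fun j =>
      inferInstanceAs (Mono ((eval A).map (α.app j)))
    Types.isPullback_of_equifibered_of_mono (isColimitOfPreserves (eval A) hc)
      (isColimitOfPreserves (eval A) hc') (α := Functor.whiskerRight α (eval A)) ((eval A).map f)
      (fun j => ((eval A).map_comp _ _).symm.trans
          (((eval A).congr_map (hw j)).trans ((eval A).map_comp _ _)))
      (fun _ _ u => isPullback_iff.1 (hα u) A) j

end SmallPresheaf

end Presheaf

/-! ### Colimits of partial maps -/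

section Par

variable {C : Type u} [Category.{v} C] {M : MorphismProperty C} [IsStableSystemOfMonics M]

/-- Translates equations in `Par` into pullback squares: applied to transition maps it yields
equifiberedness, and applied to cocone legs it yields the squares fed to universality. -/
theorem PartialMap.ofHom_comp_mk_eq_iff {X Y Z : C} (f : X ⟶ Y) (q : PartialSpan M Y Z)
    (p : PartialSpan M X Z) :
    comp (ofHom M f) (Quotient.mk (PartialSpan.setoid M Y Z) q) =
        Quotient.mk (PartialSpan.setoid M X Z) p ↔
      ∃ t : p.dom ⟶ q.dom, IsPullback p.incl t f q.incl ∧ t ≫ q.map = p.map := by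
  constructor
  · intro h
    have := PartialSpan.hasPullback (PartialSpan.ofHom M f) q
    have hp : IsPullback _ _ f q.incl :=
      IsPullback.of_hasPullback (PartialSpan.ofHom M f).map q.incl
    rw [ofHom_comp_mk f q hp (IsStableSystemOfMonics.of_isPullback hp.flip q.mem)] at h
    obtain ⟨e, h₁, h₂⟩ := Quotient.exact (s := PartialSpan.setoid M X Z) h
    dsimp only at e h₁ h₂
    refine ⟨e.inv ≫ pullback.snd _ _, ?_, ?_⟩
    · exact hp.of_iso e (Iso.refl _) (Iso.refl _) (Iso.refl _) (by rw [h₁]; exact Category.comp_id _) (by simp)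
        (by simp) (by simp)
    · rw [Category.assoc, ← h₂, e.inv_hom_id_assoc]
  · rintro ⟨t, h, ht⟩
    rw [ofHom_comp_mk f q h p.mem]
    exact Quotient.sound (s := PartialSpan.setoid M X Z) ⟨Iso.refl _, by simp, by simp [ht]⟩

/-- A universal colimit along which equifibered families in `M` descend is preserved by the
inclusion into the category of partial maps. -/
theorem Par.nonempty_isColimit_inclusion_mapCocone {J : Type*} [Category J]
    [HasColimitsOfShape J C] {F : J ⥤ C} {c : Cocone F} (hu : IsUniversalColimit c)
    (hd : ∀ {F' : J ⥤ C} {c' : Cocone F'}, IsColimit c' → ∀ (α : F' ⟶ F) (f : c'.pt ⟶ c.pt),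
      (∀ j, α.app j ≫ c.ι.app j = c'.ι.app j ≫ f) → NatTrans.Equifibered α →
      (∀ j, M (α.app j)) → M f ∧ ∀ j, IsPullback (c'.ι.app j) (α.app j) f (c.ι.app j)) :
    Nonempty (IsColimit ((Par.inclusion M).mapCocone c)) := by
  have H : ∀ s : Cocone (F ⋙ Par.inclusion M), ∃! φ : (Par.inclusion M).obj c.pt ⟶ s.pt,
      ∀ j, (Par.inclusion M).map (c.ι.app j) ≫ φ = s.ι.app j := by
    intro s
    have hs : ∀ j, ∃ p : PartialSpan M (F.obj j) s.pt.of,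
        Quotient.mk (PartialSpan.setoid M _ _) p = s.ι.app j := fun j => Quotient.exists_rep _
    choose p hp using hs
    have ht : ∀ ⦃i j : J⦄ (u : i ⟶ j), ∃ t : (p i).dom ⟶ (p j).dom,
        IsPullback (p i).incl t (F.map u) (p j).incl ∧ t ≫ (p j).map = (p i).map := fun i j u => by
      rw [← PartialMap.ofHom_comp_mk_eq_iff, hp, hp]
      exact s.w u
    choose t ht ht' using ht
    have hmono : ∀ j, Mono (p j).incl := fun j => IsStableSystemOfMonics.mono _ (p j).mem
    -- The domains form a functor because the inclusions are monic, so each transition map `t u` is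
    -- determined by `F.map u`.
    let F' : J ⥤ C :=
      { obj := fun j => (p j).dom
        map := fun u => t u
        map_id := fun j => by
          rw [← cancel_mono (p j).incl, ← (ht (𝟙 j)).w]
          simp
        map_comp := fun {i j k} u u' => by
          rw [← cancel_mono (p k).incl, ← (ht (u ≫ u')).w, Category.assoc, ← (ht u').w,
            ← Category.assoc (t u), ← (ht u).w]
          simp }
    let α : F' ⟶ F := { app := fun j => (p j).incl, naturality := fun i j u => (ht u).w.symm }
    let k : Cocone F' :=
      { pt := s.pt.of
        ι := { app := fun j => (p j).map
               naturality := fun i j u => (ht' u).trans (Category.comp_id _).symm } }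
    have hα : NatTrans.Equifibered α := fun i j u => (ht u).flip
    have hf : ∀ j, α.app j ≫ c.ι.app j =
        (colimit.cocone F').ι.app j ≫ (colimit.isColimit F').desc ((Cocone.precompose α).obj c) :=
      fun j => ((colimit.isColimit F').fac ((Cocone.precompose α).obj c) j).symm
    obtain ⟨hM, hP⟩ := hd (colimit.isColimit F') α _ hf hα fun j => (p j).mem
    refine ⟨Quotient.mk (PartialSpan.setoid M _ _)
      ⟨colimit F', _, (colimit.isColimit F').desc k, hM⟩, fun j => ?_, fun φ hφ => ?_⟩
    · rw [← hp j]
      exact (PartialMap.ofHom_comp_mk_eq_iff _ _ _).2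
        ⟨_, (hP j).flip, (colimit.isColimit F').fac k j⟩
    · obtain ⟨q, rfl⟩ : ∃ q : PartialSpan M c.pt s.pt.of,
          Quotient.mk (PartialSpan.setoid M _ _) q = φ := Quotient.exists_rep _
      have hr : ∀ j, ∃ r : (p j).dom ⟶ q.dom,
          IsPullback (p j).incl r (c.ι.app j) q.incl ∧ r ≫ q.map = (p j).map := fun j => by
        rw [← PartialMap.ofHom_comp_mk_eq_iff, hp]
        exact hφ j
      choose r hr hr' using hr
      have := IsStableSystemOfMonics.mono _ q.mem
      let c' : Cocone F' :=
        { pt := q.dom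
          ι := { app := r
                 naturality := fun i j u => by
                  change t u ≫ r j = r i ≫ 𝟙 _
                  rw [← cancel_mono q.incl, Category.assoc, ← (hr j).w, Category.comp_id,
                    ← (hr i).w, ← Category.assoc, ← (ht u).w, Category.assoc, c.w] } }
      -- The domain of any competing `q` is also a colimit of `F'`, by universality, so it is
      -- isomorphic to `colimit F'` compatibly with both legs.
      obtain ⟨hc'⟩ := hu c' α q.incl (by ext j; exact (hr j).w) hα fun j => (hr j).flip
      refine Quotient.sound (s := PartialSpan.setoid M _ _)
        ⟨hc'.coconePointUniqueUpToIso (colimit.isColimit F'), ?_, ?_⟩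
      · refine hc'.hom_ext fun j => ?_
        rw [IsColimit.comp_coconePointUniqueUpToIso_hom_assoc, ← hf]
        exact (hr j).w
      · refine hc'.hom_ext fun j => ?_
        rw [IsColimit.comp_coconePointUniqueUpToIso_hom_assoc]
        exact ((colimit.isColimit F').fac k j).trans (hr' j).symm
  choose φ hφ hφ' using H
  exact ⟨{ desc := φ, fac := hφ, uniq := hφ' }⟩

end Par

/-! ### The stable system of monics on small presheaves -/

namespace smallPresheafMaps

variable {C : Type u} [Category.{v} C] {M : MorphismProperty C}

theorem mono [IsStableSystemOfMonics M] {P Q : SmallPresheaf C} {μ : P ⟶ Q}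
    (hμ : smallPresheafMaps M μ) : Mono μ where
  right_cancellation a b hab := SmallPresheaf.hom_ext_of_yoneda fun D x => by
    obtain ⟨A, m, t, hm, h⟩ := hμ D ((x ≫ a) ≫ μ)
    have := IsStableSystemOfMonics.mono m hm
    have : Mono ((isSmallPresheaf C).ι.map ((smallYoneda C).map m)) :=
      inferInstanceAs (Mono (yoneda.map m))
    have : Mono ((smallYoneda C).map m) := (isSmallPresheaf C).ι.mono_of_mono_map this
    have hb : (x ≫ b) ≫ μ = 𝟙 _ ≫ (x ≫ a) ≫ μ := by
      rw [Category.id_comp, Category.assoc, Category.assoc, hab]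
    -- Both `x ≫ a` and `x ≫ b` lift to sections of the monomorphism `ym`, and such a section is
    -- unique.
    have hl : h.lift (x ≫ a) (𝟙 _) (Category.id_comp _).symm = h.lift (x ≫ b) (𝟙 _) hb := by
      rw [← cancel_mono ((smallYoneda C).map m), h.lift_snd, h.lift_snd]
    rw [← h.lift_fst (x ≫ a) (𝟙 _) (Category.id_comp _).symm, hl, h.lift_fst]

theorem of_isPullback {P X Y Z : SmallPresheaf C} {fst : P ⟶ X} {snd : P ⟶ Y} {μ : X ⟶ Z}
    {f : Y ⟶ Z} (h : IsPullback fst snd μ f) (hμ : smallPresheafMaps M μ) :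
    smallPresheafMaps M snd := fun D γ => by
  obtain ⟨A, m, t, hm, h'⟩ := hμ D (γ ≫ f)
  exact ⟨A, m, _, hm, h'.of_right' h⟩

theorem hasPullback {X Y Z : SmallPresheaf C} (μ : X ⟶ Z) (f : Y ⟶ Z)
    (hμ : smallPresheafMaps M μ) : HasPullback μ f := by
  have h : IsPullback (pullback.fst μ.hom f.hom) (pullback.snd μ.hom f.hom) μ.hom f.hom :=
    IsPullback.of_hasPullback _ _
  have hW : isSmallPresheaf C (pullback μ.hom f.hom) :=
    isSmallPresheaf_of_isPullback h Y.property fun D γ => by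
      obtain ⟨A, m, t, -, h'⟩ := hμ D (ObjectProperty.homMk γ)
      exact ⟨A, t.hom, yoneda.map m, SmallPresheaf.isPullback_ι_map h'⟩
  let W : SmallPresheaf C := ⟨_, hW⟩
  have h' : IsPullback (ObjectProperty.homMk (pullback.fst μ.hom f.hom) : W ⟶ X)
      (ObjectProperty.homMk (pullback.snd μ.hom f.hom) : W ⟶ Y) μ f :=
    IsPullback.of_map_of_faithful (isSmallPresheaf C).ι h
  exact h'.hasPullback

theorem isStableSystemOfMonics [IsStableSystemOfMonics M] :
    IsStableSystemOfMonics (smallPresheafMaps M) where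
  mono _ h := h.mono
  of_isIso e _ D γ := ⟨D, 𝟙 D, γ ≫ inv e, IsStableSystemOfMonics.of_isIso _ inferInstance,
    IsPullback.of_vert_isIso ⟨by simp⟩⟩
  comp μ ν hμ hν D γ := by
    obtain ⟨A, m, t, hm, h⟩ := hν D γ
    obtain ⟨B, n, s, hn, h'⟩ := hμ A t
    refine ⟨B, n ≫ m, s, IsStableSystemOfMonics.comp _ _ hn hm, ?_⟩
    rw [Functor.map_comp]
    exact h'.paste_vert h
  hasPullback := hasPullback
  of_isPullback := of_isPullback

/-- A map from a representable into the colimit factors through some `F.obj j`, where membership of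
`α.app j` supplies a pullback square to paste with the descent square. -/
theorem of_isColimit {J : Type v} [Category.{v} J] [IsStableSystemOfMonics M]
    {F : J ⥤ SmallPresheaf C} {c : Cocone F} (hc : IsColimit c) {F' : J ⥤ SmallPresheaf C}
    {c' : Cocone F'} (hc' : IsColimit c') (α : F' ⟶ F) (f : c'.pt ⟶ c.pt)
    (hw : ∀ j, α.app j ≫ c.ι.app j = c'.ι.app j ≫ f) (hα : NatTrans.Equifibered α)
    (hM : ∀ j, smallPresheafMaps M (α.app j)) :
    smallPresheafMaps M f ∧ ∀ j, IsPullback (c'.ι.app j) (α.app j) f (c.ι.app j) := by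
  have := fun j => (hM j).mono
  have hp := SmallPresheaf.isPullback_of_equifibered_of_mono hc hc' f hw hα
  refine ⟨fun D γ => ?_, hp⟩
  obtain ⟨j, y, rfl⟩ := SmallPresheaf.exists_fac_of_isColimit hc γ
  obtain ⟨A, m, t, hm, h⟩ := hM j D y
  exact ⟨A, m, _, hm, h.paste_horiz (hp j)⟩

theorem isCocompleteMCategory [IsStableSystemOfMonics M] :
    IsCocompleteMCategory.{v} (smallPresheafMaps M) where
  stable := isStableSystemOfMonics
  hasColimits := SmallPresheaf.hasColimitsOfSize
  preservesColimits :=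
    letI := isStableSystemOfMonics (M := M)
    ⟨⟨⟨fun hc => Par.nonempty_isColimit_inclusion_mapCocone
      (SmallPresheaf.isUniversalColimit_of_isColimit hc) (of_isColimit hc)⟩⟩⟩

theorem isStableUnderCoproducts [IsStableSystemOfMonics M] :
    MorphismProperty.IsStableUnderCoproducts.{v} (smallPresheafMaps M) where
  isStableUnderCoproductsOfShape _ :=
    { condition := fun _ _ _ _ hc' hc α hα f hf =>
        (of_isColimit hc hc' α f (fun j => (hf j).symm) (NatTrans.Equifibered.of_discrete α) hα).1 }

/-- Representables are projective with respect to epimorphisms, since these are pointwise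
surjective; lift `γ` and paste. -/
theorem descendsAlong_epimorphisms :
    (smallPresheafMaps M).DescendsAlong (MorphismProperty.epimorphisms (SmallPresheaf C)) where
  of_isPullback {_ _ _ _ _ _ f μ} h hf hfst D γ := by
    have : Epi f := hf
    obtain ⟨y, rfl⟩ := SmallPresheaf.exists_fac_of_epi f γ
    obtain ⟨A, m, t, hm, h'⟩ := hfst D y
    exact ⟨A, m, _, hm, h'.paste_horiz h.flip⟩

end smallPresheafMaps

theorem mainTheorem11 {C : Type u} [Category.{v} C] (M : MorphismProperty C)
    (hM : IsLocallySmallMCategory.{v} M) :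
    -- small presheaves form a cocomplete `M`-category
    IsCocompleteMCategory.{v} (smallPresheafMaps M) ∧
    -- the class is closed under small coproducts and descends along epimorphisms
    MorphismProperty.IsStableUnderCoproducts.{v} (smallPresheafMaps M) ∧
    (smallPresheafMaps M).DescendsAlong (MorphismProperty.epimorphisms (SmallPresheaf C)) ∧
    -- small colimits are computed pointwise
    (∀ (J : Type v) [Category.{v} J] (F : J ⥤ SmallPresheaf C) (c : Cocone F),
      Nonempty (IsColimit c) ↔
        ∀ A : C, Nonempty (IsColimit ((SmallPresheaf.eval A).mapCocone c))) ∧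
    -- pullbacks are computed pointwise
    (∀ {P Q R S : SmallPresheaf C} (t : P ⟶ Q) (l : P ⟶ R) (r : Q ⟶ S) (b : R ⟶ S),
      IsPullback t l r b ↔
        ∀ A : C, IsPullback ((SmallPresheaf.eval A).map t) ((SmallPresheaf.eval A).map l)
          ((SmallPresheaf.eval A).map r) ((SmallPresheaf.eval A).map b)) := by
  have := hM.stable
  exact ⟨smallPresheafMaps.isCocompleteMCategory, smallPresheafMaps.isStableUnderCoproducts,
    smallPresheafMaps.descendsAlong_epimorphisms, fun _ _ _ _ => SmallPresheaf.nonempty_isColimit_iff,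
    fun _ _ _ _ => SmallPresheaf.isPullback_iff⟩
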